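/- Let $\Gamma=(V,E)$ be a simple undirected graph without loops and let $\mathcal M=\{M_\alpha:\alpha\in V\}$ be a family of pairwise disjoint monoids. Put $X=\bigcup_{\alpha\in V}M_\alpha$, write $s(x)=\alpha$ for $x\in M_\alpha$, and let $X^*$ be the free monoid on $X$, with juxtaposition $\circ$ and empty word $\epsilon$. The graph product is the monoid $\mathscr{GP}=\mathscr{GP}(\Gamma,\mathcal M)=\langle X\mid R\rangle$, where $R$ consists of the relations $1_\alpha=\epsilon$ ($\alpha\in V$), $x\circ y=xy$ ($x,y\in M_\alpha$, $\alpha\in V$) and $x\circ y=y\circ x$ ($x\in M_\alpha$, $y\in M_\beta$, $\{\alpha,\beta\}\in E$). The class of a word $w$ in $\mathscr{GP}$ is denoted by $[w]$, and $s(w)\subseteq V$ is the set of vertices $s(x)$ of the letters $x$ of $w$. For elements $a,b$ of a monoid $M$ write $a\,\mathcal R^*\,b$ if for all $x,y\in M$ one has $xa=ya\Leftrightarrow xb=yb$. The monoid $M$ is left abundant if each of its elements is $\mathcal R^*$-related to an idempotent of $M$. A word $x_1\circ\cdots\circ x_n$ is reduced if no $x_i$ is an identity $1_\alpha$ and, whenever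 $i<j$ and $s(x_i)=s(x_j)$, there is $k$ with $i<k<j$ and $\{s(x_i),s(x_k)\}\notin E$. A word $w=w_1\circ\cdots\circ w_k$ ($k\ge 0$, $w_i\in X^*$) is a left Foata normal form with blocks $w_1,\dots,w_k$ if it is reduced, any two distinct vertices in $s(w_i)$ are adjacent for each $i$, and for all $1\le i<k$ and $\alpha\in s(w_{i+1})$ there is $\beta\in s(w_i)$ with $\{\alpha,\beta\}\notin E$. Its first block is $w_1$, read as $\epsilon$ if $k=0$. A letter $x\in X$ is left invertible if it has a left inverse in $M_{s(x)}$. **Theorem.** Suppose that every $M_\alpha$ is left abundant. Then: 1. $\mathscr{GP}$ is left abundant. 2. For every $u\in X^*$ there are words $a,v\in X^*$ such that (D) $[u]=[a][v]$, all letters of $a$ are left invertible, and $v$ is a left Foata normal form whose first block $v_1=z_1\circ\cdots\circ z_s$ contains no left invertible letter; moreover they can be chosen such that $a\circ v$ is reduced, there are idempotents $z_j^+\in M_{s(z_j)}$ with $z_j^+\,\mathcal R^*\,z_j$ in $M_{s(z_j)}$ for $1\le j\le s$, and there is a word $a'$ with $[a'][a]=[\epsilon]$. 3. For every $u\in X^*$,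 all $a,v$ satisfying (D) with first block $v_1=z_1\circ\cdots\circ z_s$ of $v$, every choice of idempotents $z_j^+\in M_{s(z_j)}$ with $z_j^+\,\mathcal R^*\,z_j$ in $M_{s(z_j)}$ for $1\le j\le s$, and every word $a'$ with $[a'][a]=[\epsilon]$, the element $[a][v_1^+][a']$, where $v_1^+=z_1^+\circ\cdots\circ z_s^+$, is idempotent and $$[u]\;\mathcal R^*\;[a][v_1^+][a'].$$ -/

import Mathlib

/-- The relation `R*` on a monoid: `a R* b` iff for all `x, y` one has
`x a = y a ↔ x b = y b`. -/
def RStar {M : Type*} [Monoid M] (a b : M) : Prop :=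
  ∀ x y : M, x * a = y * a ↔ x * b = y * b

/-- A monoid is left abundant if every element is `R*`-related to an idempotent. -/
def IsLeftAbundant (M : Type*) [Monoid M] : Prop :=
  ∀ a : M, ∃ e : M, IsIdempotentElem e ∧ RStar a e

namespace GraphProd

/-- The alphabet `X`: the disjoint union of the vertex monoids. The vertex `x.1` of a letter `x`
is the value `s(x)`. -/
abbrev Letter {V : Type*} (M : V → Type*) : Type _ := Σ α : V, M α

/-- Words over the alphabet; juxtaposition is `++`, the empty word is `[]`. -/
abbrev Word {V : Type*} (M : V → Type*) : Type _ := List (Letter M)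

section

variable {V : Type*} (Γ : SimpleGraph V) (M : V → Type*) [∀ α, Monoid (M α)]

/-- The defining relations `R_id`, `R_v` and `R_e` of the graph product. -/
inductive Rel : FreeMonoid (Letter M) → FreeMonoid (Letter M) → Prop
  | id (α : V) : Rel (FreeMonoid.of ⟨α, 1⟩) 1
  | vertex (α : V) (x y : M α) :
      Rel (FreeMonoid.of ⟨α, x⟩ * FreeMonoid.of ⟨α, y⟩) (FreeMonoid.of ⟨α, x * y⟩)
  | edge (α β : V) (h : Γ.Adj α β) (x : M α) (y : M β) :
      Rel (FreeMonoid.of ⟨α, x⟩ * FreeMonoid.of ⟨β, y⟩)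
        (FreeMonoid.of ⟨β, y⟩ * FreeMonoid.of ⟨α, x⟩)

/-- The graph product of the monoids `M α` with respect to the graph `Γ`. -/
abbrev GraphProduct : Type _ := PresentedMonoid (Rel Γ M)

variable {M}

/-- The class `[w]` of a word `w` in the graph product. -/
def cls (w : Word M) : GraphProduct Γ M :=
  PresentedMonoid.mk (Rel Γ M) (FreeMonoid.ofList w)

/-- The support `s(w)` of a word: the set of vertices of its letters. -/
def support {V : Type*} {M : V → Type*} (w : Word M) : Set V := {α | ∃ x ∈ w, x.1 = α}

/-- A word is reduced if no letter is an identity, and between any two letters from the same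
vertex monoid there is a letter whose vertex is not adjacent to their vertex. -/
def IsReducedWord (w : Word M) : Prop :=
  (∀ i : Fin w.length, (w.get i).2 ≠ 1) ∧
  ∀ i j : Fin w.length, i < j → (w.get i).1 = (w.get j).1 →
    ∃ k : Fin w.length, i < k ∧ k < j ∧ ¬ Γ.Adj (w.get i).1 (w.get k).1

/-- The word `w₁ ∘ ⋯ ∘ w_k`, the concatenation of the list `ws = [w₁, …, w_k]`, is a left Foata
normal form with blocks `w₁, …, w_k`. By the third condition an empty block can only be followed
by empty blocks. -/
def IsLeftFoata (ws : List (Word M)) : Prop :=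
  IsReducedWord Γ ws.flatten ∧
  (∀ w ∈ ws, Γ.IsClique (support w)) ∧
  ws.IsChain (fun w w' => ∀ α ∈ support w', ∃ β ∈ support w, ¬ Γ.Adj α β)

/-- The first block; it is the empty word if the block length is `0`. -/
def firstBlock {V : Type*} {M : V → Type*} (ws : List (Word M)) : Word M := ws.headD []

/-- A letter `x` is left invertible if it has a left inverse in its vertex monoid. -/
def LeftInvertible (x : Letter M) : Prop := ∃ y : M x.1, y * x.2 = 1

/-- `[u] = [a][v]`, where all letters of `a` are left invertible and `v` is a left Foata normal form
with list of blocks `vs`, whose first block contains no left invertible letter. -/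
structure IsDecomposition (u a : Word M) (vs : List (Word M)) : Prop where
  cls_eq : cls Γ u = cls Γ a * cls Γ vs.flatten
  leftInvertible : ∀ x ∈ a, LeftInvertible x
  leftFoata : IsLeftFoata Γ vs
  not_leftInvertible : ∀ x ∈ firstBlock vs, ¬ LeftInvertible x

/-- The letters `z` and `e` belong to the same vertex monoid, in which `e` is an idempotent that
is `R*`-related to `z`. -/
def IsPlusLetter (z e : Letter M) : Prop :=
  ∃ (α : V) (z₀ e₀ : M α), z = ⟨α, z₀⟩ ∧ e = ⟨α, e₀⟩ ∧ IsIdempotentElem e₀ ∧ RStar e₀ z₀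

/-- `z = z₁ ∘ ⋯ ∘ z_s` and `e = z₁⁺ ∘ ⋯ ∘ z_s⁺`, where each `z_j⁺` is an idempotent of the vertex
monoid of `z_j` that is `R*`-related to `z_j`. -/
def IsPlusWord (z e : Word M) : Prop := List.Forall₂ IsPlusLetter z e

end

end GraphProd

open GraphProd

/-! Right multiplication is studied in a concrete model, in the manner of van der Waerden: the graph
product acts on the right on reduced traces, that is, reduced words up to commutation. Over each
vertex `α` a reduced trace splits uniquely into a stem not ending in `α` and an element of `M α`
(`push_bijective`), so `M α` acts freely through the second coordinate. Levi's lemma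
(`Trace.snoc_eq_snoc`) makes the actions of adjacent vertices commute. Hence the defining relations
act correctly, and letting `g` act on the empty trace gives a normal form `nf g`; its second
coordinate over `α` is `fin α g`.

Let a left Foata normal form be `z` followed by further blocks, with no left invertible letter in
`z`. Over the vertex of a letter `x` of `z`, the last factor of `g * z` is that of `g` times `x`,
hence nontrivial. Each vertex of the next block is non-adjacent to some vertex of `z`, so the last
factors there are trivial and that block can be cancelled; it leaves nontrivial factors for the
block after it. Thus everything after `z` cancels (`IsLeftFoata.eq_of_mul_tail_eq`), and freeness
lets each letter of `z` be exchanged for its idempotent (`mul_singleton_eq_of_rStar`). So `[v]` is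
`R*`-related to `[v₁⁺]`. The factor `[a]` is absorbed into the multipliers, and `[a']` on the right
is undone by multiplying by `[a]`.

Decompositions exist because left invertible letters that can reach the front are collected in `a`
and all others are inserted into Foata blocks (`exists_shuffleEquiv`). Left abundance follows by
combining existence with the `R*` statement. -/

namespace GraphProd

/-! ### Traces: shuffle equivalence, Levi's lemma and reducedness. -/

section Trace

variable {V : Type*} (Γ : SimpleGraph V) {M : V → Type*}

open Classical in
/-- The subword of the letters lying over the vertices `α` and `β`. -/
noncomputable def restrict (w : Word M) (α β : V) : Word M :=
  w.filter fun x => x.1 = α ∨ x.1 = β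

@[simp] lemma restrict_nil (α β : V) : restrict ([] : Word M) α β = [] := rfl

@[simp] lemma restrict_append (w w' : Word M) (α β : V) :
    restrict (w ++ w') α β = restrict w α β ++ restrict w' α β := by
  simp [restrict]

lemma restrict_singleton_of_mem {x : Letter M} {α β : V} (h : x.1 = α ∨ x.1 = β) :
    restrict [x] α β = [x] := by
  simp [restrict, h]

lemma restrict_singleton_of_notMem {x : Letter M} {α β : V} (h : ¬ (x.1 = α ∨ x.1 = β)) :
    restrict [x] α β = [] := by
  simp only [restrict, List.filter_singleton]
  simp [h]

lemma restrict_eq_nil {w : Word M} {α β : V} (h : ∀ x ∈ w, ¬ (x.1 = α ∨ x.1 = β)) :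
    restrict w α β = [] := by
  simpa [restrict, List.filter_eq_nil_iff] using h

/-- Two words are shuffle equivalent if they have the same restriction to every pair of
non-adjacent vertices. -/
def shuffleSetoid : Setoid (Word M) where
  r w w' := ∀ α β, ¬ Γ.Adj α β → restrict w α β = restrict w' α β
  iseqv :=
    { refl := fun _ _ _ _ => rfl
      symm := fun h α β hαβ => (h α β hαβ).symm
      trans := fun h h' α β hαβ => (h α β hαβ).trans (h' α β hαβ) }

/-- Shuffle equivalence of words. -/
def ShuffleEquiv (w w' : Word M) : Prop := (shuffleSetoid Γ (M := M)) w w'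

variable {Γ}

namespace ShuffleEquiv

lemma refl (w : Word M) : ShuffleEquiv Γ w w := fun _ _ _ => rfl

lemma symm {w w' : Word M} (h : ShuffleEquiv Γ w w') : ShuffleEquiv Γ w' w :=
  fun α β hαβ => (h α β hαβ).symm

lemma trans {u v w : Word M} (h : ShuffleEquiv Γ u v) (h' : ShuffleEquiv Γ v w) :
    ShuffleEquiv Γ u w :=
  fun α β hαβ => (h α β hαβ).trans (h' α β hαβ)

lemma append {u u' v v' : Word M} (h : ShuffleEquiv Γ u u') (h' : ShuffleEquiv Γ v v') :
    ShuffleEquiv Γ (u ++ v) (u' ++ v') := fun α β hαβ => by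
  rw [restrict_append, restrict_append, h α β hαβ, h' α β hαβ]

lemma append_right_cancel {u u' v : Word M} (h : ShuffleEquiv Γ (u ++ v) (u' ++ v)) :
    ShuffleEquiv Γ u u' := fun α β hαβ => by
  simpa using h α β hαβ

/-- A restriction to two non-adjacent (possibly equal) vertices never keeps both `x` and a letter of
`w`, so it cannot see their order. -/
lemma singleton_append {x : Letter M} {w : Word M} (h : ∀ y ∈ w, Γ.Adj x.1 y.1) :
    ShuffleEquiv Γ ([x] ++ w) (w ++ [x]) := fun α β hαβ => by
  rw [restrict_append, restrict_append]
  by_cases hx : x.1 = α ∨ x.1 = β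
  · rw [restrict_eq_nil (w := w), List.append_nil, List.nil_append]
    intro y hy hy'
    have := h y hy
    rcases hx with hx | hx <;> rcases hy' with hy' | hy' <;> rw [hx, hy'] at this
    · exact Γ.irrefl this
    · exact hαβ this
    · exact hαβ this.symm
    · exact Γ.irrefl this
  · rw [restrict_singleton_of_notMem hx, List.append_nil, List.nil_append]

end ShuffleEquiv

/-- If every restriction of `w` involving the vertex of `x` ends with `x`, then `x` occurs in `w`
and commutes with all the letters to its right. -/
lemma exists_append_of_restrict_eq {x : Letter M} {w : Word M}
    (h : ∀ β, ¬ Γ.Adj x.1 β → ∃ l, restrict w x.1 β = l ++ [x]) :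
    ∃ p r, w = p ++ ([x] ++ r) ∧ ∀ y ∈ r, Γ.Adj x.1 y.1 := by
  induction w using List.reverseRecOn with
  | nil =>
    -- The choice `β = x.1` is allowed since `Γ` has no loops.
    obtain ⟨l, hl⟩ := h x.1 Γ.irrefl
    simp at hl
  | append_singleton w y ih =>
    by_cases hxy : Γ.Adj x.1 y.1
    · obtain ⟨p, r, rfl, hr⟩ := ih fun β hβ => by
        obtain ⟨l, hl⟩ := h β hβ
        rw [restrict_append, restrict_singleton_of_notMem, List.append_nil] at hl
        · exact ⟨l, hl⟩
        · rintro (h' | h')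
          · exact hxy.ne h'.symm
          · exact hβ (h' ▸ hxy)
      refine ⟨p, r ++ [y], by simp, ?_⟩
      intro z hz
      rcases List.mem_append.1 hz with hz | hz
      · exact hr z hz
      · rwa [List.mem_singleton.1 hz]
    -- The restriction to `x.1` and `y.1` ends in `y` by position and in `x` by hypothesis, so the
    -- two letters agree.
    · obtain ⟨l, hl⟩ := h y.1 hxy
      rw [restrict_append, restrict_singleton_of_mem (Or.inr rfl)] at hl
      have : y = x := by simpa using (List.append_inj' hl rfl).2
      subst this
      exact ⟨w, [], by simp, by simp⟩

/-- Cancellation of a last letter. It drives every induction that passes from equal restrictions to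
actual commutations. -/
lemma ShuffleEquiv.exists_append {x : Letter M} {w w' : Word M}
    (h : ShuffleEquiv Γ (w ++ [x]) w') :
    ∃ p r, w' = p ++ ([x] ++ r) ∧ (∀ y ∈ r, Γ.Adj x.1 y.1) ∧ ShuffleEquiv Γ w (p ++ r) := by
  obtain ⟨p, r, rfl, hr⟩ := exists_append_of_restrict_eq (Γ := Γ) (x := x) (w := w') fun β hβ =>
    ⟨restrict w x.1 β, by
      rw [← h x.1 β hβ, restrict_append, restrict_singleton_of_mem (Or.inl rfl)]⟩
  refine ⟨p, r, rfl, hr, ?_⟩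
  have := h.trans ((ShuffleEquiv.refl p).append (ShuffleEquiv.singleton_append hr))
  rw [← List.append_assoc] at this
  exact this.append_right_cancel

variable (Γ M) in
/-- Words up to shuffle equivalence. -/
def Trace : Type _ := Quotient (shuffleSetoid Γ (M := M))

namespace Trace

variable (Γ) in
/-- The trace of a word. -/
def mk (w : Word M) : Trace Γ M := Quotient.mk _ w

lemma mk_eq_mk {w w' : Word M} : mk Γ w = mk Γ w' ↔ ShuffleEquiv Γ w w' := Quotient.eq

lemma mk_surjective : Function.Surjective (mk Γ (M := M)) := Quotient.mk_surjective

/-- Appending a letter to a trace. -/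
def snoc (q : Trace Γ M) (x : Letter M) : Trace Γ M :=
  Quotient.map (· ++ [x]) (fun _ _ h => ShuffleEquiv.append h (ShuffleEquiv.refl [x])) q

lemma mk_append_singleton (w : Word M) (x : Letter M) : mk Γ (w ++ [x]) = (mk Γ w).snoc x := rfl

lemma snoc_comm (q : Trace Γ M) {x y : Letter M} (h : Γ.Adj x.1 y.1) :
    (q.snoc x).snoc y = (q.snoc y).snoc x := by
  obtain ⟨w, rfl⟩ := mk_surjective q
  simp only [← mk_append_singleton, mk_eq_mk, List.append_assoc]
  exact (ShuffleEquiv.refl w).append (ShuffleEquiv.singleton_append (by simpa using h))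

lemma snoc_ne_nil (q : Trace Γ M) (x : Letter M) : q.snoc x ≠ mk Γ [] := by
  obtain ⟨w, rfl⟩ := mk_surjective q
  rw [← mk_append_singleton, Ne, mk_eq_mk]
  intro h
  obtain ⟨p, r, h, -⟩ := h.exists_append
  simp at h

/-- Levi's lemma for traces. -/
lemma snoc_eq_snoc {q q' : Trace Γ M} {x y : Letter M} (h : q.snoc x = q'.snoc y) :
    (x = y ∧ q = q') ∨ (Γ.Adj x.1 y.1 ∧ ∃ s : Trace Γ M, q = s.snoc y ∧ q' = s.snoc x) := by
  obtain ⟨w, rfl⟩ := mk_surjective q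
  obtain ⟨w', rfl⟩ := mk_surjective q'
  simp only [← mk_append_singleton, mk_eq_mk] at h
  obtain ⟨p, r, hw, hr, hs⟩ := h.exists_append
  -- Only a case split: the last letter `y` of `w'` is either the located `x` or the last letter of
  -- `r`.
  induction r using List.reverseRecOn with
  | nil =>
    obtain ⟨h1, h2⟩ := List.append_inj' (s₁ := w') (t₁ := [y]) (s₂ := p) (t₂ := [x])
      (by simpa using hw) rfl
    left
    refine ⟨by simpa using h2.symm, mk_eq_mk.2 ?_⟩
    rw [h1]
    simpa using hs
  | append_singleton r z =>
    obtain ⟨h1, h2⟩ := List.append_inj' (s₁ := w') (t₁ := [y]) (s₂ := p ++ ([x] ++ r)) (t₂ := [z])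
      (by simpa using hw) rfl
    obtain rfl : y = z := by simpa using h2
    right
    refine ⟨hr y (by simp), mk Γ (p ++ r), ?_, ?_⟩
    · rw [← mk_append_singleton, mk_eq_mk]
      simpa using hs
    · rw [← mk_append_singleton, mk_eq_mk, h1, List.append_assoc]
      exact (ShuffleEquiv.refl p).append
        (ShuffleEquiv.singleton_append fun y hy => hr y (by simp [hy]))

/-- A trace ends in `α` if it has a representative whose last letter lies over `α`. -/
def EndsIn (α : V) (q : Trace Γ M) : Prop := ∃ (m : M α) (q' : Trace Γ M), q = q'.snoc ⟨α, m⟩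

lemma endsIn_snoc (x : Letter M) (q : Trace Γ M) : (q.snoc x).EndsIn x.1 := ⟨x.2, q, rfl⟩

lemma EndsIn.snoc_of_adj {α : V} {q : Trace Γ M} (h : q.EndsIn α) {x : Letter M}
    (hx : Γ.Adj α x.1) : (q.snoc x).EndsIn α := by
  obtain ⟨m, q, rfl⟩ := h
  exact ⟨m, q.snoc x, q.snoc_comm hx⟩

lemma EndsIn.of_snoc {α : V} {q : Trace Γ M} {x : Letter M} (h : (q.snoc x).EndsIn α)
    (hx : x.1 ≠ α) : Γ.Adj x.1 α ∧ q.EndsIn α := by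
  obtain ⟨m, q', h⟩ := h
  rcases snoc_eq_snoc h with ⟨rfl, -⟩ | ⟨hadj, s, rfl, -⟩
  · exact absurd rfl hx
  · exact ⟨hadj, m, s, rfl⟩

lemma endsIn_mk {α : V} {w : Word M} : (mk Γ w).EndsIn α ↔
    ∃ p y r, w = p ++ ([y] ++ r) ∧ y.1 = α ∧ ∀ z ∈ r, Γ.Adj α z.1 := by
  constructor
  · rintro ⟨m, q, h⟩
    obtain ⟨w', rfl⟩ := mk_surjective q
    rw [← mk_append_singleton, mk_eq_mk] at h
    obtain ⟨p, r, rfl, hr, -⟩ := h.symm.exists_append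
    exact ⟨p, ⟨α, m⟩, r, rfl, rfl, hr⟩
  · rintro ⟨p, y, r, rfl, rfl, hr⟩
    refine ⟨y.2, mk Γ (p ++ r), ?_⟩
    rw [← mk_append_singleton, mk_eq_mk, List.append_assoc]
    exact (ShuffleEquiv.refl p).append (ShuffleEquiv.singleton_append hr)

variable [∀ α, Monoid (M α)]

/-- Reduced traces. -/
inductive Reduced : Trace Γ M → Prop
  | nil : Reduced (mk Γ [])
  | snoc (q : Trace Γ M) (x : Letter M) (hq : Reduced q) (hx : x.2 ≠ 1) (h : ¬ q.EndsIn x.1) :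
      Reduced (q.snoc x)

/-- `Reduced` records one order of building the trace; Levi's lemma shows that any other choice of
last letter works as well. -/
lemma reduced_snoc_iff {q : Trace Γ M} {x : Letter M} :
    (q.snoc x).Reduced ↔ q.Reduced ∧ x.2 ≠ 1 ∧ ¬ q.EndsIn x.1 := by
  refine ⟨fun h => ?_, fun h => .snoc q x h.1 h.2.1 h.2.2⟩
  generalize hs : q.snoc x = s at h
  induction h generalizing q with
  | nil => exact absurd hs (snoc_ne_nil q x)
  | snoc q' y hq' hy hend ih =>
    rcases snoc_eq_snoc hs with ⟨rfl, rfl⟩ | ⟨hadj, s, rfl, rfl⟩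
    · exact ⟨hq', hy, hend⟩
    · obtain ⟨h1, h2, h3⟩ := ih rfl
      refine ⟨.snoc s y h1 hy fun h => hend (h.snoc_of_adj hadj.symm), h2, fun h => ?_⟩
      exact h3 (h.of_snoc hadj.ne').2

end Trace

/-- A description of reduced words by factorizations. -/
lemma isReducedWord_iff [∀ α, Monoid (M α)] {w : Word M} : IsReducedWord Γ w ↔
    (∀ x ∈ w, x.2 ≠ 1) ∧ ∀ p x q y r, w = p ++ x :: (q ++ y :: r) → x.1 = y.1 →
      ∃ z ∈ q, ¬ Γ.Adj x.1 z.1 := by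
  refine and_congr (List.forall_mem_iff_get (p := fun x : Letter M => x.2 ≠ 1)).symm ⟨?_, ?_⟩
  · rintro h p x q y r rfl hxy
    obtain ⟨k, h1, h2, h3⟩ := h ⟨p.length, by simp⟩ ⟨p.length + 1 + q.length, by simp; omega⟩
      (by simp [Fin.lt_def]; omega)
      (by simpa [List.getElem_append, List.getElem_cons, Nat.add_assoc, Nat.add_sub_cancel_left]
        using hxy)
    obtain ⟨k, hk⟩ := k
    simp only [Fin.lt_def] at h1 h2
    obtain ⟨j, rfl⟩ : ∃ j, k = p.length + (1 + j) := ⟨k - p.length - 1, by omega⟩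
    have hj : j < q.length := by omega
    refine ⟨q[j], List.getElem_mem hj, ?_⟩
    have e : (1 + j) = j + 1 := by omega
    simpa [List.getElem_append_right, e, hj] using h3
  · intro h i j hij hs
    obtain ⟨i, hi⟩ := i
    obtain ⟨j, hj⟩ := j
    simp only [Fin.lt_def] at hij
    have e1 : w = w.take i ++ w[i] :: w.drop (i + 1) := by simp
    have e2 : w.drop (i + 1) =
        (w.drop (i + 1)).take (j - (i + 1)) ++ w[j] :: w.drop (j + 1) := by
      have hlt : j - (i + 1) < (w.drop (i + 1)).length := by simp; omega
      have := List.take_append_drop (j - (i + 1)) (w.drop (i + 1))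
      rw [List.drop_eq_getElem_cons hlt] at this
      rw [List.getElem_drop, List.drop_drop] at this
      have e3 : i + 1 + (j - (i + 1)) = j := by omega
      have e4 : i + 1 + (j - (i + 1) + 1) = j + 1 := by omega
      simp only [e3, e4] at this
      exact this.symm
    obtain ⟨z, hz, hadj⟩ := h _ _ _ _ _ (e1.trans (congrArg (fun t => w.take i ++ w[i] :: t) e2)) hs
    obtain ⟨k, hk, rfl⟩ := List.getElem_of_mem hz
    simp at hk
    refine ⟨⟨i + 1 + k, by omega⟩, ?_, ?_, ?_⟩
    · simp only [Fin.lt_def]; omega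
    · simp only [Fin.lt_def]; omega
    · simpa using hadj

lemma isReducedWord_iff_reduced_mk [∀ α, Monoid (M α)] {w : Word M} :
    IsReducedWord Γ w ↔ (Trace.mk Γ w).Reduced := by
  induction w using List.reverseRecOn with
  | nil => exact ⟨fun _ => .nil, fun _ => isReducedWord_iff.2 ⟨by simp, by simp⟩⟩
  | append_singleton w x ih =>
    rw [Trace.mk_append_singleton, Trace.reduced_snoc_iff, ← ih, Trace.endsIn_mk,
      isReducedWord_iff, isReducedWord_iff]
    constructor
    · rintro ⟨h1, h2⟩
      refine ⟨⟨fun y hy => h1 y (by simp [hy]), ?_⟩, h1 x (by simp), ?_⟩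
      · rintro p a q b r rfl hab
        exact h2 p a q b (r ++ [x]) (by simp) hab
      · rintro ⟨p, y, r, rfl, hy, hr⟩
        obtain ⟨z, hz, hadj⟩ := h2 p y r x [] (by simp) hy
        exact hadj (hy ▸ hr z hz)
    · rintro ⟨⟨h1, h2⟩, h3, h4⟩
      refine ⟨fun y hy => ?_, ?_⟩
      · rcases List.mem_append.1 hy with hy | hy
        · exact h1 y hy
        · rwa [List.mem_singleton.1 hy]
      · intro p a q b r hw hab
        -- If `r` is empty, the pair ends at the new letter `x`; otherwise it lies inside `w`.
        induction r using List.reverseRecOn with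
        | nil =>
          obtain ⟨e1, e2⟩ := List.append_inj' (s₁ := w) (t₁ := [x]) (s₂ := p ++ a :: q) (t₂ := [b])
            (by simpa using hw) rfl
          obtain rfl : x = b := by simpa using e2
          by_contra! hcon
          exact h4 ⟨p, a, q, by simpa using e1, hab, fun z hz => hab ▸ hcon z hz⟩
        | append_singleton r c =>
          obtain ⟨e1, -⟩ := List.append_inj' (s₁ := w) (t₁ := [x]) (s₂ := p ++ a :: (q ++ b :: r))
            (t₂ := [c]) (by simpa using hw) rfl
          exact h2 p a q b r e1 hab

lemma IsReducedWord.of_append_right [∀ α, Monoid (M α)] {u v : Word M}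
    (h : IsReducedWord Γ (u ++ v)) : IsReducedWord Γ v := by
  rw [isReducedWord_iff] at h ⊢
  refine ⟨fun x hx => h.1 x (by simp [hx]), ?_⟩
  rintro p x q y r rfl
  exact h.2 (u ++ p) x q y r (by simp)

lemma IsReducedWord.of_append_left [∀ α, Monoid (M α)] {u v : Word M}
    (h : IsReducedWord Γ (u ++ v)) : IsReducedWord Γ u := by
  rw [isReducedWord_iff] at h ⊢
  refine ⟨fun x hx => h.1 x (by simp [hx]), ?_⟩
  rintro p x q y r rfl
  exact h.2 p x q y (r ++ v) (by simp)

end Trace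

/-! ### Normal forms from the right action on reduced traces. -/

section NormalForm

variable {V : Type*} (Γ : SimpleGraph V) {M : V → Type*} [∀ α, Monoid (M α)]

lemma cls_append (u v : Word M) : cls Γ (u ++ v) = cls Γ u * cls Γ v := by
  simp [cls, FreeMonoid.ofList_append]

@[simp] lemma cls_nil : cls Γ ([] : Word M) = 1 := rfl

lemma cls_cons (x : Letter M) (w : Word M) : cls Γ (x :: w) = cls Γ [x] * cls Γ w :=
  cls_append Γ [x] w

lemma cls_surjective : Function.Surjective (cls Γ (M := M)) := fun g => by
  obtain ⟨w, rfl⟩ := PresentedMonoid.surjective_mk g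
  exact ⟨FreeMonoid.toList w, rfl⟩

lemma cls_singleton_one (α : V) : cls Γ [(⟨α, 1⟩ : Letter M)] = 1 :=
  PresentedMonoid.mk_eq_mk_of_rel (Rel.id α)

lemma cls_singleton_mul {α : V} (a b : M α) :
    cls Γ [(⟨α, a⟩ : Letter M)] * cls Γ [⟨α, b⟩] = cls Γ [⟨α, a * b⟩] :=
  PresentedMonoid.mk_eq_mk_of_rel (Rel.vertex α a b)

variable {Γ}

lemma commute_cls_singleton {x y : Letter M} (h : Γ.Adj x.1 y.1) :
    Commute (cls Γ [x]) (cls Γ [y]) :=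
  PresentedMonoid.mk_eq_mk_of_rel (Rel.edge x.1 y.1 h x.2 y.2)

lemma commute_cls {x : Letter M} {w : Word M} (h : ∀ y ∈ w, Γ.Adj x.1 y.1) :
    Commute (cls Γ [x]) (cls Γ w) := by
  induction w with
  | nil => simp
  | cons y w ih =>
    rw [cls_cons]
    exact (commute_cls_singleton (h y (by simp))).mul_right (ih fun z hz => h z (by simp [hz]))

/-- The last letter of `w` occurs in `w'` and commutes with all that follows it there, so the
defining relations move it to the end. -/
lemma ShuffleEquiv.cls_eq {w w' : Word M} (h : ShuffleEquiv Γ w w') : cls Γ w = cls Γ w' := by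
  induction w using List.reverseRecOn generalizing w' with
  | nil =>
    induction w' using List.reverseRecOn with
    | nil => rfl
    | append_singleton w' x =>
      obtain ⟨p, r, h, -⟩ := h.symm.exists_append
      simp at h
  | append_singleton w x ih =>
    obtain ⟨p, r, rfl, hr, hs⟩ := h.exists_append
    rw [cls_append, ih hs, cls_append, cls_append, cls_append, (commute_cls hr).eq, mul_assoc]

namespace Trace

/-- The element of the graph product represented by a trace. -/
def val : Trace Γ M → GraphProduct Γ M :=
  Quotient.lift (cls Γ) fun _ _ h => ShuffleEquiv.cls_eq h

lemma val_mk (w : Word M) : (mk Γ w).val = cls Γ w := rfl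

lemma val_snoc (q : Trace Γ M) (x : Letter M) : (q.snoc x).val = q.val * cls Γ [x] := by
  obtain ⟨w, rfl⟩ := mk_surjective q
  exact cls_append Γ w [x]

end Trace

variable (Γ M) in
/-- The reduced traces. -/
abbrev RedTrace : Type _ := {q : Trace Γ M // q.Reduced}

variable (Γ M) in
/-- The reduced traces not ending in `α`. -/
abbrev Stem (α : V) : Type _ := {q : Trace Γ M // q.Reduced ∧ ¬ q.EndsIn α}

open Classical in
/-- Appending a possibly trivial letter over `α` to a reduced trace not ending in `α`. -/
noncomputable def push (α : V) (p : Stem Γ M α × M α) : RedTrace Γ M :=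
  if h : p.2 = 1 then ⟨p.1, p.1.2.1⟩
  else ⟨p.1.1.snoc ⟨α, p.2⟩, .snoc _ _ p.1.2.1 h p.1.2.2⟩

lemma coe_push_one {α : V} (q : Stem Γ M α) : (push α (q, 1)).1 = q.1 := by
  simp [push]

lemma coe_push_of_ne {α : V} (q : Stem Γ M α) {a : M α} (ha : a ≠ 1) :
    (push α (q, a)).1 = q.1.snoc ⟨α, a⟩ := by
  simp [push, ha]

lemma val_push {α : V} (q : Stem Γ M α) (a : M α) :
    (push α (q, a)).1.val = q.1.val * cls Γ [⟨α, a⟩] := by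
  by_cases ha : a = 1
  · rw [ha, coe_push_one, cls_singleton_one, mul_one]
  · rw [coe_push_of_ne q ha, Trace.val_snoc]

lemma endsIn_push {α : V} (q : Stem Γ M α) {a : M α} (ha : a ≠ 1) :
    (push α (q, a)).1.EndsIn α := by
  rw [coe_push_of_ne q ha]
  exact Trace.endsIn_snoc ⟨α, a⟩ _

lemma not_endsIn_push {α β : V} {q : Stem Γ M α} (hq : ¬ q.1.EndsIn β) (hαβ : α ≠ β) (a : M α) :
    ¬ (push α (q, a)).1.EndsIn β := by
  by_cases ha : a = 1
  · rwa [ha, coe_push_one]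
  · rw [coe_push_of_ne q ha]
    exact fun h => hq (h.of_snoc hαβ).2

/-- The image ends in `α` exactly when the second coordinate is nontrivial. Two last letters over
`α` must coincide by Levi's lemma, since its adjacency alternative would be a loop. -/
lemma push_bijective (α : V) : Function.Bijective (push (Γ := Γ) (M := M) α) := by
  constructor
  · rintro ⟨q, a⟩ ⟨r, b⟩ h
    by_cases ha : a = 1
    · by_cases hb : b = 1
      · subst ha hb
        have := congrArg Subtype.val h
        rw [coe_push_one, coe_push_one] at this
        rw [Subtype.ext this]
      · have := endsIn_push r hb
        rw [← h, ha, coe_push_one] at this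
        exact absurd this q.2.2
    · by_cases hb : b = 1
      · have := endsIn_push q ha
        rw [h, hb, coe_push_one] at this
        exact absurd this r.2.2
      · have := congrArg Subtype.val h
        rw [coe_push_of_ne _ ha, coe_push_of_ne _ hb] at this
        rcases Trace.snoc_eq_snoc this with ⟨h1, h2⟩ | ⟨h1, -⟩
        · rw [Subtype.ext h2, eq_of_heq (Sigma.mk.inj h1).2]
        · exact absurd h1 Γ.irrefl
  · rintro ⟨q, hq⟩
    by_cases h : q.EndsIn α
    · obtain ⟨m, q, rfl⟩ := h
      obtain ⟨h1, h2, h3⟩ := Trace.reduced_snoc_iff.1 hq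
      exact ⟨(⟨q, h1, h3⟩, m), Subtype.ext (coe_push_of_ne _ h2)⟩
    · exact ⟨(⟨q, hq, h⟩, 1), Subtype.ext (coe_push_one _)⟩

variable (Γ M) in
/-- The reduced traces form a free right `M α`-set with basis the reduced traces that do not end
in `α`. -/
noncomputable def pushEquiv (α : V) : Stem Γ M α × M α ≃ RedTrace Γ M :=
  Equiv.ofBijective (push α) (push_bijective α)

lemma pushEquiv_apply {α : V} (p : Stem Γ M α × M α) : pushEquiv Γ M α p = push α p := rfl

/-- Right multiplication of a reduced trace by an element of a vertex monoid. -/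
noncomputable def act (α : V) (m : M α) (q : RedTrace Γ M) : RedTrace Γ M :=
  push α (((pushEquiv Γ M α).symm q).1, ((pushEquiv Γ M α).symm q).2 * m)

lemma act_push {α : V} (q : Stem Γ M α) (a m : M α) : act α m (push α (q, a)) = push α (q, a * m) := by
  rw [act, ← pushEquiv_apply (q, a), Equiv.symm_apply_apply]

lemma exists_push (α : V) (q : RedTrace Γ M) : ∃ (r : Stem Γ M α) (a : M α), q = push α (r, a) := by
  obtain ⟨⟨r, a⟩, h⟩ := (push_bijective α).2 q
  exact ⟨r, a, h.symm⟩

lemma act_one (α : V) (q : RedTrace Γ M) : act α 1 q = q := by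
  obtain ⟨r, a, rfl⟩ := exists_push α q
  rw [act_push, mul_one]

lemma act_act (α : V) (m n : M α) (q : RedTrace Γ M) : act α n (act α m q) = act α (m * n) q := by
  obtain ⟨r, a, rfl⟩ := exists_push α q
  rw [act_push, act_push, act_push, mul_assoc]

lemma val_act (α : V) (m : M α) (q : RedTrace Γ M) :
    (act α m q).1.val = q.1.val * cls Γ [⟨α, m⟩] := by
  obtain ⟨r, a, rfl⟩ := exists_push α q
  rw [act_push, val_push, val_push, mul_assoc, cls_singleton_mul]

lemma push_push_comm {α β : V} (h : Γ.Adj α β) {q : Trace Γ M} (hq : q.Reduced)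
    (hα : ¬ q.EndsIn α) (hβ : ¬ q.EndsIn β) (a : M α) (b : M β) :
    push α (⟨(push β (⟨q, hq, hβ⟩, b)).1, (push β (⟨q, hq, hβ⟩, b)).2,
      not_endsIn_push hα h.ne' b⟩, a) =
    push β (⟨(push α (⟨q, hq, hα⟩, a)).1, (push α (⟨q, hq, hα⟩, a)).2,
      not_endsIn_push hβ h.ne a⟩, b) := by
  apply Subtype.ext
  by_cases ha : a = 1
  · subst ha
    by_cases hb : b = 1
    · subst hb
      simp only [coe_push_one]
    · simp only [coe_push_of_ne _ hb, coe_push_one]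
  · by_cases hb : b = 1
    · subst hb
      simp only [coe_push_of_ne _ ha, coe_push_one]
    · simp only [coe_push_of_ne _ ha, coe_push_of_ne _ hb]
      exact (q.snoc_comm h).symm

/-- Over adjacent vertices, a reduced trace is of the form `q a b` with `q` not ending in either
vertex. -/
lemma exists_push_push {α β : V} (h : Γ.Adj α β) (t : Stem Γ M α) :
    ∃ (q : Trace Γ M) (hq : q.Reduced) (hα : ¬ q.EndsIn α) (hβ : ¬ q.EndsIn β) (b : M β),
      t = ⟨(push β (⟨q, hq, hβ⟩, b)).1, (push β (⟨q, hq, hβ⟩, b)).2,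
        not_endsIn_push hα h.ne' b⟩ := by
  obtain ⟨t, ht, hend⟩ := t
  obtain ⟨⟨q, hq, hβ⟩, b, hb⟩ := exists_push β (⟨t, ht⟩ : RedTrace Γ M)
  obtain rfl := congrArg Subtype.val hb
  refine ⟨q, hq, fun hα => hend ?_, hβ, b, rfl⟩
  by_cases hb : b = 1
  · subst hb
    rwa [coe_push_one]
  · simp only [coe_push_of_ne _ hb]
    exact hα.snoc_of_adj h

/-- Over adjacent vertices, the action of one vertex monoid respects the decomposition given by
the other one. -/
lemma act_push_of_adj {α β : V} (h : Γ.Adj α β) (t : Stem Γ M α) (m : M β) :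
    ∃ t' : Stem Γ M α, ∀ a : M α, act β m (push α (t, a)) = push α (t', a) := by
  obtain ⟨q, hq, hα, hβ, b, rfl⟩ := exists_push_push h t
  refine ⟨⟨(push β (⟨q, hq, hβ⟩, b * m)).1, (push β (⟨q, hq, hβ⟩, b * m)).2,
    not_endsIn_push hα h.ne' _⟩, fun a => ?_⟩
  rw [push_push_comm h hq hα hβ, act_push, push_push_comm h hq hα hβ]

/-- In coordinates over `α`, the action of `M β` changes only the stem and that of `M α` only the
last factor. -/
lemma act_comm {α β : V} (h : Γ.Adj α β) (a : M α) (b : M β) (q : RedTrace Γ M) :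
    act β b (act α a q) = act α a (act β b q) := by
  obtain ⟨t, c, rfl⟩ := exists_push α q
  obtain ⟨t', ht'⟩ := act_push_of_adj h t b
  rw [act_push, ht', ht', act_push]

/-- The right action of a letter on the reduced traces. -/
noncomputable def letterAct (x : Letter M) : (Function.End (RedTrace Γ M))ᵐᵒᵖ :=
  MulOpposite.op (act x.1 x.2)

variable (Γ M) in
/-- The right action of the graph product on the reduced traces. -/
noncomputable def actHom : GraphProduct Γ M →* (Function.End (RedTrace Γ M))ᵐᵒᵖ :=
  PresentedMonoid.lift letterAct <| by
    rintro _ _ (⟨α⟩ | ⟨α, x, y⟩ | ⟨α, β, h, x, y⟩)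
    · simp only [FreeMonoid.lift_eval_of, map_one]
      exact congrArg MulOpposite.op (funext fun q => act_one α q)
    · simp only [FreeMonoid.lift_eval_of, map_mul]
      exact congrArg MulOpposite.op (funext fun q => act_act α x y q)
    · simp only [FreeMonoid.lift_eval_of, map_mul]
      exact congrArg MulOpposite.op (funext fun q => act_comm h x y q)

/-- The normal form of an element of the graph product, a reduced trace. -/
noncomputable def nf (g : GraphProduct Γ M) : RedTrace Γ M :=
  (actHom Γ M g).unop ⟨Trace.mk Γ [], .nil⟩

lemma nf_one : nf (1 : GraphProduct Γ M) = ⟨Trace.mk Γ [], .nil⟩ := by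
  simp only [nf, map_one]
  rfl

lemma nf_mul_singleton (g : GraphProduct Γ M) (x : Letter M) :
    nf (g * cls Γ [x]) = act x.1 x.2 (nf g) := by
  rw [nf, map_mul, MulOpposite.unop_mul]
  rfl

/-- This makes `nf` injective, so equations in the graph product can be tested on reduced traces. -/
lemma val_nf (g : GraphProduct Γ M) : (nf g).1.val = g := by
  obtain ⟨w, rfl⟩ := cls_surjective Γ g
  induction w using List.reverseRecOn with
  | nil => rw [cls_nil, nf_one]; rfl
  | append_singleton w x ih => rw [cls_append, nf_mul_singleton, val_act, ih]

lemma nf_injective : Function.Injective (nf (Γ := Γ) (M := M)) := fun g h hgh => by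
  rw [← val_nf g, hgh, val_nf]

/-- The right action of a vertex monoid on the graph product is free. -/
lemma nf_eq_push_mul {α : V} {g : GraphProduct Γ M} {t : Stem Γ M α} {a : M α}
    (h : nf g = push α (t, a)) (m : M α) : nf (g * cls Γ [⟨α, m⟩]) = push α (t, a * m) := by
  rw [nf_mul_singleton, h, act_push]

/-- The last factor over `α` of an element of the graph product. -/
noncomputable def fin (α : V) (g : GraphProduct Γ M) : M α := ((pushEquiv Γ M α).symm (nf g)).2

lemma fin_eq {α : V} {g : GraphProduct Γ M} {t : Stem Γ M α} {a : M α}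
    (h : nf g = push α (t, a)) : fin α g = a := by
  rw [fin, h, ← pushEquiv_apply, Equiv.symm_apply_apply]

lemma fin_mul_self {α : V} (g : GraphProduct Γ M) (m : M α) :
    fin α (g * cls Γ [⟨α, m⟩]) = fin α g * m := by
  obtain ⟨t, a, h⟩ := exists_push α (nf g)
  rw [fin_eq (nf_eq_push_mul h m), fin_eq h]

lemma fin_mul_of_adj {α : V} {x : Letter M} (hx : Γ.Adj α x.1) (g : GraphProduct Γ M) :
    fin α (g * cls Γ [x]) = fin α g := by
  obtain ⟨t, a, h⟩ := exists_push α (nf g)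
  obtain ⟨t', ht'⟩ := act_push_of_adj hx t x.2
  have h' : nf (g * cls Γ [x]) = push α (t', a) := by rw [nf_mul_singleton, h, ht']
  rw [fin_eq h, fin_eq h']

lemma fin_mul_word {α : V} {w : Word M} (hw : ∀ y ∈ w, Γ.Adj α y.1) (g : GraphProduct Γ M) :
    fin α (g * cls Γ w) = fin α g := by
  induction w generalizing g with
  | nil => rw [cls_nil, mul_one]
  | cons x w ih =>
    rw [cls_cons, ← mul_assoc, ih (fun y hy => hw y (by simp [hy])),
      fin_mul_of_adj (hw x (by simp))]

lemma endsIn_nf_of_fin_ne {α : V} {g : GraphProduct Γ M} (h : fin α g ≠ 1) :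
    (nf g).1.EndsIn α := by
  obtain ⟨t, a, hg⟩ := exists_push α (nf g)
  rw [fin_eq hg] at h
  rw [hg]
  exact endsIn_push t h

/-- Only one of two distinct non-adjacent vertices can carry a nontrivial last factor. -/
lemma fin_eq_one {α β : V} (hne : α ≠ β) (hadj : ¬ Γ.Adj α β) {g : GraphProduct Γ M}
    (h : fin β g ≠ 1) : fin α g = 1 := by
  by_contra hα
  obtain ⟨m, q, hq⟩ := endsIn_nf_of_fin_ne h
  have := endsIn_nf_of_fin_ne hα
  rw [hq] at this
  exact hadj (this.of_snoc hne.symm).1.symm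

/-- Right multiplication by a letter can be cancelled on elements without last factor over its
vertex. -/
lemma eq_of_mul_singleton_eq {x : Letter M} {g h : GraphProduct Γ M} (hg : fin x.1 g = 1)
    (hh : fin x.1 h = 1) (heq : g * cls Γ [x] = h * cls Γ [x]) : g = h := by
  obtain ⟨t, a, ht⟩ := exists_push x.1 (nf g)
  obtain ⟨s, b, hs⟩ := exists_push x.1 (nf h)
  obtain rfl : a = 1 := by rw [← hg, fin_eq ht]
  obtain rfl : b = 1 := by rw [← hh, fin_eq hs]
  have := congrArg nf heq
  rw [nf_eq_push_mul ht, nf_eq_push_mul hs] at this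
  have hts : t = s := (Prod.ext_iff.1 ((push_bijective x.1).1 this)).1
  apply nf_injective
  rw [ht, hs, hts]

/-- The embedding of a vertex monoid into the graph product respects `R*`. -/
lemma mul_singleton_eq_of_rStar {α : V} {z e : M α} (hze : RStar e z) {g h : GraphProduct Γ M}
    (heq : g * cls Γ [⟨α, z⟩] = h * cls Γ [⟨α, z⟩]) :
    g * cls Γ [⟨α, e⟩] = h * cls Γ [⟨α, e⟩] := by
  obtain ⟨t, a, ht⟩ := exists_push α (nf g)
  obtain ⟨s, b, hs⟩ := exists_push α (nf h)
  have := congrArg nf heq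
  rw [nf_eq_push_mul ht, nf_eq_push_mul hs] at this
  obtain ⟨h1, h2⟩ := Prod.ext_iff.1 ((push_bijective α).1 this)
  apply nf_injective
  rw [nf_eq_push_mul ht, nf_eq_push_mul hs]
  have h2' : a * e = b * e := (hze a b).2 h2
  have h1' : t = s := h1
  rw [h1', h2']

/-- Every element of the graph product is represented by a reduced word. -/
lemma exists_isReducedWord (g : GraphProduct Γ M) : ∃ w, IsReducedWord Γ w ∧ cls Γ w = g := by
  obtain ⟨w, hw⟩ := Trace.mk_surjective (nf g).1
  refine ⟨w, isReducedWord_iff_reduced_mk.2 (hw ▸ (nf g).2), ?_⟩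
  rw [← Trace.val_mk, hw, val_nf]

end NormalForm

/-! ### Inserting letters into Foata blocks. -/

section Insertion

variable {V : Type*} {Γ : SimpleGraph V} {M : V → Type*}

lemma mem_support {w : Word M} {x : Letter M} (h : x ∈ w) : x.1 ∈ support w := ⟨x, h, rfl⟩

open Classical in
variable (Γ) in
/-- Right insertion of a letter into a list of blocks: the letter joins the first block such that
it commutes with this block and all later ones. -/
noncomputable def insertLetter (x : Letter M) : List (Word M) → List (Word M)
  | [] => [[x]]
  | w :: ws => if ∀ y ∈ w ++ ws.flatten, Γ.Adj x.1 y.1 then (w ++ [x]) :: ws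
      else w :: insertLetter x ws

lemma insertLetter_cons_of_adj {x : Letter M} {w : Word M} {ws : List (Word M)}
    (h : ∀ y ∈ w ++ ws.flatten, Γ.Adj x.1 y.1) :
    insertLetter Γ x (w :: ws) = (w ++ [x]) :: ws := by
  rw [insertLetter, if_pos h]

lemma insertLetter_cons_of_not_adj {x : Letter M} {w : Word M} {ws : List (Word M)}
    (h : ¬ ∀ y ∈ w ++ ws.flatten, Γ.Adj x.1 y.1) :
    insertLetter Γ x (w :: ws) = w :: insertLetter Γ x ws := by
  rw [insertLetter, if_neg h]

lemma shuffleEquiv_insertLetter (x : Letter M) (ws : List (Word M)) :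
    ShuffleEquiv Γ (ws.flatten ++ [x]) (insertLetter Γ x ws).flatten := by
  induction ws with
  | nil => exact ShuffleEquiv.refl [x]
  | cons w ws ih =>
    by_cases h : ∀ y ∈ w ++ ws.flatten, Γ.Adj x.1 y.1
    · rw [insertLetter_cons_of_adj h, List.flatten_cons, List.flatten_cons, List.append_assoc,
        List.append_assoc]
      exact (ShuffleEquiv.refl w).append
        (ShuffleEquiv.singleton_append fun y hy => h y (by simp [hy])).symm
    · rw [insertLetter_cons_of_not_adj h, List.flatten_cons, List.flatten_cons, List.append_assoc]
      exact (ShuffleEquiv.refl w).append ih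

lemma support_append_singleton (w : Word M) (x : Letter M) :
    support (w ++ [x]) = insert x.1 (support w) := by
  ext α
  simp only [support, List.mem_append, List.mem_singleton, Set.mem_ofPred_eq, Set.mem_insert_iff]
  constructor
  · rintro ⟨y, hy | rfl, rfl⟩
    · exact Or.inr ⟨y, hy, rfl⟩
    · exact Or.inl rfl
  · rintro (rfl | ⟨y, hy, rfl⟩)
    · exact ⟨x, Or.inr rfl, rfl⟩
    · exact ⟨y, Or.inl hy, rfl⟩

lemma isClique_insertLetter (x : Letter M) {ws : List (Word M)}
    (h : ∀ w ∈ ws, Γ.IsClique (support w)) :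
    ∀ w ∈ insertLetter Γ x ws, Γ.IsClique (support w) := by
  induction ws with
  | nil =>
    intro w hw
    obtain rfl : w = [x] := by simpa [insertLetter] using hw
    rintro _ ⟨y, hy, rfl⟩ _ ⟨z, hz, rfl⟩ hne
    rw [List.mem_singleton.1 hy, List.mem_singleton.1 hz] at hne
    exact absurd rfl hne
  | cons w ws ih =>
    by_cases hx : ∀ y ∈ w ++ ws.flatten, Γ.Adj x.1 y.1
    · rw [insertLetter_cons_of_adj hx]
      intro v hv
      rcases List.mem_cons.1 hv with rfl | hv
      · rw [support_append_singleton]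
        refine (h w (by simp)).insert ?_
        rintro _ ⟨y, hy, rfl⟩ -
        exact hx y (by simp [hy])
      · exact h v (by simp [hv])
    · rw [insertLetter_cons_of_not_adj hx]
      intro v hv
      rcases List.mem_cons.1 hv with rfl | hv
      · exact h v (by simp)
      · exact ih (fun w hw => h w (by simp [hw])) v hv

/-- The chain condition on the blocks of a left Foata normal form. -/
def IsFoataChain (Γ : SimpleGraph V) (ws : List (Word M)) : Prop :=
  ws.IsChain fun w w' => ∀ α ∈ support w', ∃ β ∈ support w, ¬ Γ.Adj α β

/-- If `x` joins the block right after `w`, it commutes with that block and all later ones, so the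
letter obstructing it must lie in `w`: this is the non-adjacent vertex the chain condition asks for.
-/
lemma IsFoataChain.cons_insertLetter {x : Letter M} {w : Word M} {ws : List (Word M)}
    (h : IsFoataChain Γ (w :: ws)) (hx : ¬ ∀ y ∈ w ++ ws.flatten, Γ.Adj x.1 y.1) :
    IsFoataChain Γ (w :: insertLetter Γ x ws) := by
  induction ws generalizing w with
  | nil =>
    refine List.isChain_cons_cons.2 ⟨?_, List.isChain_singleton _⟩
    rintro _ ⟨y, hy, rfl⟩
    rw [List.mem_singleton.1 hy]
    push Not at hx
    obtain ⟨z, hz, hadj⟩ := hx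
    exact ⟨z.1, mem_support (by simpa using hz), hadj⟩
  | cons v ws ih =>
    obtain ⟨h1, h2⟩ := List.isChain_cons_cons.1 h
    by_cases hv : ∀ y ∈ v ++ ws.flatten, Γ.Adj x.1 y.1
    · rw [insertLetter_cons_of_adj hv]
      refine List.isChain_cons_cons.2 ⟨?_, ?_⟩
      · intro α hα
        rw [support_append_singleton] at hα
        rcases Set.mem_insert_iff.1 hα with rfl | hα
        · push Not at hx
          obtain ⟨z, hz, hadj⟩ := hx
          rcases List.mem_append.1 hz with hz | hz
          · exact ⟨z.1, mem_support hz, hadj⟩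
          · exact absurd (hv z (by simpa using hz)) hadj
        · exact h1 α hα
      · cases ws with
        | nil => exact List.isChain_singleton _
        | cons u ws =>
          obtain ⟨h3, h4⟩ := List.isChain_cons_cons.1 h2
          refine List.isChain_cons_cons.2 ⟨fun α hα => ?_, h4⟩
          obtain ⟨β, hβ, hadj⟩ := h3 α hα
          exact ⟨β, by rw [support_append_singleton]; exact Set.mem_insert_of_mem _ hβ, hadj⟩
    · rw [insertLetter_cons_of_not_adj hv]
      exact List.isChain_cons_cons.2 ⟨h1, ih h2 hv⟩

lemma IsFoataChain.insertLetter (x : Letter M) {ws : List (Word M)} (h : IsFoataChain Γ ws) :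
    IsFoataChain Γ (insertLetter Γ x ws) := by
  cases ws with
  | nil => exact List.isChain_singleton _
  | cons w ws =>
    by_cases hx : ∀ y ∈ w ++ ws.flatten, Γ.Adj x.1 y.1
    · rw [insertLetter_cons_of_adj hx]
      cases ws with
      | nil => exact List.isChain_singleton _
      | cons u ws =>
        obtain ⟨h3, h4⟩ := List.isChain_cons_cons.1 h
        refine List.isChain_cons_cons.2 ⟨fun α hα => ?_, h4⟩
        obtain ⟨β, hβ, hadj⟩ := h3 α hα
        exact ⟨β, by rw [support_append_singleton]; exact Set.mem_insert_of_mem _ hβ, hadj⟩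
    · rw [insertLetter_cons_of_not_adj hx]
      exact h.cons_insertLetter hx

/-- If `x` does not commute with all letters, its insertion does not change the first block. -/
lemma firstBlock_insertLetter {x : Letter M} {ws : List (Word M)}
    (hx : ¬ ∀ y ∈ ws.flatten, Γ.Adj x.1 y.1) :
    firstBlock (insertLetter Γ x ws) = firstBlock ws := by
  cases ws with
  | nil => simp at hx
  | cons w ws =>
    rw [insertLetter_cons_of_not_adj (by simpa using hx)]
    rfl

lemma firstBlock_insertLetter_subset (x : Letter M) (ws : List (Word M)) :
    ∀ y ∈ firstBlock (insertLetter Γ x ws), y ∈ firstBlock ws ∨ y = x := by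
  cases ws with
  | nil => simp [insertLetter, firstBlock]
  | cons w ws =>
    by_cases hx : ∀ y ∈ w ++ ws.flatten, Γ.Adj x.1 y.1
    · rw [insertLetter_cons_of_adj hx]
      simp [firstBlock]
    · rw [insertLetter_cons_of_not_adj hx]
      exact fun y hy => Or.inl hy

end Insertion

/-! ### Cancellation along left Foata normal forms. -/

section Foata

variable {V : Type*} {Γ : SimpleGraph V} {M : V → Type*} [∀ α, Monoid (M α)]

/-- The letters of a reduced word over a clique are pairwise adjacent. -/
lemma IsReducedWord.pairwise_adj {w : Word M} (hw : IsReducedWord Γ w)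
    (hc : Γ.IsClique (support w)) : w.Pairwise fun x y => Γ.Adj x.1 y.1 := by
  suffices h : w.Pairwise fun x y => x.1 ≠ y.1 from
    h.imp_of_mem fun hx hy hne => hc (mem_support hx) (mem_support hy) hne
  induction w with
  | nil => exact .nil
  | cons x w ih =>
    have hw' : w.Pairwise fun x y => x.1 ≠ y.1 :=
      ih (IsReducedWord.of_append_right (u := [x]) hw)
        (hc.subset <| by rintro _ ⟨y, hy, rfl⟩; exact mem_support (by simp [hy]))
    refine List.pairwise_cons.2 ⟨fun y hy hxy => ?_, hw'⟩
    obtain ⟨q, r, rfl⟩ := List.append_of_mem hy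
    obtain ⟨z, hz, hadj⟩ := (isReducedWord_iff.1 hw).2 [] x q y r rfl hxy
    have hzy : z.1 ≠ y.1 := (List.pairwise_append.1 hw').2.2 z hz y (by simp)
    exact hadj (hc (mem_support (by simp)) (mem_support (by simp [hz])) (hxy ▸ hzy.symm))

/-- The supports of consecutive cliques in a reduced word are disjoint. -/
lemma IsReducedWord.notMem_support {w w' : Word M} (h : IsReducedWord Γ (w ++ w'))
    (hc : Γ.IsClique (support w)) (hc' : Γ.IsClique (support w')) {α : V} (hα : α ∈ support w) :
    α ∉ support w' := by
  rintro ⟨y, hy, hyα⟩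
  obtain ⟨x, hx, rfl⟩ := hα
  have hp := h.of_append_left.pairwise_adj hc
  have hp' := h.of_append_right.pairwise_adj hc'
  obtain ⟨p, q, rfl⟩ := List.append_of_mem hx
  obtain ⟨p', r, rfl⟩ := List.append_of_mem hy
  obtain ⟨z, hz, hadj⟩ := (isReducedWord_iff.1 h).2 p x (q ++ p') y r (by simp) hyα.symm
  rcases List.mem_append.1 hz with hz | hz
  · exact hadj ((List.pairwise_cons.1 (List.pairwise_append.1 hp).2.1).1 z hz)
  · exact hadj (hyα ▸ ((List.pairwise_append.1 hp').2.2 z hz y (by simp)).symm)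

lemma IsLeftFoata.tail {w : Word M} {ws : List (Word M)} (h : IsLeftFoata Γ (w :: ws)) :
    IsLeftFoata Γ ws :=
  ⟨IsReducedWord.of_append_right (u := w) (by simpa using h.1), fun v hv => h.2.1 v (by simp [hv]),
    h.2.2.tail⟩

lemma IsLeftFoata.pairwise_adj {w : Word M} {ws : List (Word M)} (h : IsLeftFoata Γ (w :: ws)) :
    w.Pairwise fun x y => Γ.Adj x.1 y.1 :=
  IsReducedWord.pairwise_adj (IsReducedWord.of_append_left (v := ws.flatten) (by simpa using h.1))
    (h.2.1 w (by simp))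

lemma fin_mul_clique {w : Word M} (hw : w.Pairwise fun x y => Γ.Adj x.1 y.1) {x : Letter M}
    (hx : x ∈ w) (g : GraphProduct Γ M) : fin x.1 (g * cls Γ w) = fin x.1 g * x.2 := by
  obtain ⟨p, q, rfl⟩ := List.append_of_mem hx
  obtain ⟨-, h1, h2⟩ := List.pairwise_append.1 hw
  rw [cls_append, cls_cons, ← mul_assoc, ← mul_assoc, fin_mul_word (List.pairwise_cons.1 h1).1,
    fin_mul_self, fin_mul_word fun y hy => (h2 y hy x (by simp)).symm]

/-- Multiplying by one letter of the clique leaves the last factors over the other vertices trivial,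
so the letters cancel one by one. -/
lemma eq_of_mul_clique_eq {w : Word M} (hw : w.Pairwise fun x y => Γ.Adj x.1 y.1)
    {g h : GraphProduct Γ M} (hg : ∀ x ∈ w, fin x.1 g = 1) (hh : ∀ x ∈ w, fin x.1 h = 1)
    (heq : g * cls Γ w = h * cls Γ w) : g = h := by
  induction w generalizing g h with
  | nil => simpa using heq
  | cons x w ih =>
    obtain ⟨h1, h2⟩ := List.pairwise_cons.1 hw
    rw [cls_cons, ← mul_assoc, ← mul_assoc] at heq
    refine eq_of_mul_singleton_eq (hg x (by simp)) (hh x (by simp)) (ih h2 ?_ ?_ heq)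
    · intro y hy
      rw [fin_mul_of_adj (h1 y hy).symm, hg y (by simp [hy])]
    · intro y hy
      rw [fin_mul_of_adj (h1 y hy).symm, hh y (by simp [hy])]

/-- In a left Foata normal form, the blocks after the first one can be cancelled on the right of
elements with nontrivial last factors over the support of the first block. -/
lemma IsLeftFoata.eq_of_mul_tail_eq {w : Word M} {ws : List (Word M)} (hf : IsLeftFoata Γ (w :: ws))
    {g h : GraphProduct Γ M} (hg : ∀ x ∈ w, fin x.1 g ≠ 1) (hh : ∀ x ∈ w, fin x.1 h ≠ 1)
    (heq : g * cls Γ ws.flatten = h * cls Γ ws.flatten) : g = h := by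
  induction ws generalizing w g h with
  | nil => simpa using heq
  | cons v ws ih =>
    have hv := hf.tail.pairwise_adj
    -- Each vertex of `v` has a non-adjacent vertex in `w`, distinct from it because the word is
    -- reduced; the nontrivial last factor there excludes one over the vertex of `v`.
    have key : ∀ k : GraphProduct Γ M, (∀ x ∈ w, fin x.1 k ≠ 1) → ∀ y ∈ v, fin y.1 k = 1 := by
      intro k hk y hy
      obtain ⟨_, ⟨x, hx, rfl⟩, hadj⟩ :=
        (List.isChain_cons_cons.1 hf.2.2).1 y.1 (mem_support hy)
      refine fin_eq_one (fun he => ?_) hadj (hk x hx)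
      refine IsReducedWord.notMem_support (Γ := Γ) (w := w) (w' := v)
        (IsReducedWord.of_append_left (v := ws.flatten) (by simpa using hf.1))
        (hf.2.1 w (by simp)) (hf.2.1 v (by simp)) (mem_support hx) ?_
      rw [← he]
      exact mem_support hy
    have key' : ∀ k : GraphProduct Γ M, (∀ x ∈ w, fin x.1 k ≠ 1) →
        ∀ y ∈ v, fin y.1 (k * cls Γ v) ≠ 1 := by
      intro k hk y hy
      rw [fin_mul_clique hv hy, key k hk y hy, one_mul]
      exact (isReducedWord_iff.1 hf.tail.1).1 y (by simp [hy])
    rw [List.flatten_cons, cls_append, ← mul_assoc, ← mul_assoc] at heq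
    -- The induction hypothesis, applied to `g * cls Γ v` and `h * cls Γ v`, removes `ws`; then `v`
    -- itself is cancelled.
    exact eq_of_mul_clique_eq hv (key g hg) (key h hh) (ih hf.tail (key' g hg) (key' h hh) heq)

/-! ### The idempotent of the first block and the `R*` relation. -/

lemma IsPlusLetter.fst_eq {z e : Letter M} (h : IsPlusLetter z e) : z.1 = e.1 := by
  obtain ⟨α, z, e, rfl, rfl, -⟩ := h
  rfl

lemma IsPlusLetter.isIdempotentElem {z e : Letter M} (h : IsPlusLetter z e) :
    IsIdempotentElem (cls Γ [e]) := by
  obtain ⟨α, z, e, rfl, rfl, he, -⟩ := h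
  rw [IsIdempotentElem, cls_singleton_mul, he.eq]

lemma IsPlusLetter.mul_eq {z e : Letter M} (h : IsPlusLetter z e) :
    cls Γ [e] * cls Γ [z] = cls Γ [z] := by
  obtain ⟨α, z, e, rfl, rfl, he, hr⟩ := h
  -- The relation `R*` is tested on the pair `e`, `1`.
  have : e * z = 1 * z := (hr e 1).1 (by rw [he.eq, one_mul])
  rw [cls_singleton_mul, this, one_mul]

lemma IsPlusLetter.mul_right_eq {z e : Letter M} (h : IsPlusLetter z e) {g k : GraphProduct Γ M}
    (heq : g * cls Γ [z] = k * cls Γ [z]) : g * cls Γ [e] = k * cls Γ [e] := by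
  obtain ⟨α, z, e, rfl, rfl, he, hr⟩ := h
  exact mul_singleton_eq_of_rStar hr heq

lemma IsPlusWord.adj {z e : Word M} (h : IsPlusWord z e) {α : V}
    (hz : ∀ x ∈ z, Γ.Adj α x.1) : ∀ x ∈ e, Γ.Adj α x.1 := by
  induction h with
  | nil => simp
  | cons h1 h2 ih =>
    intro x hx
    rcases List.mem_cons.1 hx with rfl | hx
    · exact h1.fst_eq ▸ hz _ (by simp)
    · exact ih (fun y hy => hz y (by simp [hy])) x hx

lemma IsPlusWord.isIdempotentElem {z e : Word M} (h : IsPlusWord z e)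
    (hz : z.Pairwise fun x y => Γ.Adj x.1 y.1) : IsIdempotentElem (cls Γ e) := by
  induction h with
  | nil => exact IsIdempotentElem.one
  | @cons x f z e h1 h2 ih =>
    obtain ⟨hx, hz⟩ := List.pairwise_cons.1 hz
    rw [cls_cons]
    refine IsIdempotentElem.mul_of_commute ?_ h1.isIdempotentElem (ih hz)
    exact commute_cls (h1.fst_eq ▸ IsPlusWord.adj h2 hx)

lemma IsPlusWord.mul_eq {z e : Word M} (h : IsPlusWord z e)
    (hz : z.Pairwise fun x y => Γ.Adj x.1 y.1) : cls Γ e * cls Γ z = cls Γ z := by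
  induction h with
  | nil => simp
  | @cons x f z e h1 h2 ih =>
    obtain ⟨hx, hz⟩ := List.pairwise_cons.1 hz
    have hc : Commute (cls Γ [x]) (cls Γ e) := commute_cls (IsPlusWord.adj h2 hx)
    rw [cls_cons _ f, cls_cons _ x, mul_assoc, ← mul_assoc (cls Γ e), ← hc.eq, mul_assoc, ih hz,
      ← mul_assoc, h1.mul_eq]

/-- Letters are exchanged one at a time: once the tail is replaced by its idempotents, these commute
with `x`, which can then be moved next to them on the right and replaced in turn. -/
lemma IsPlusWord.mul_right_eq {z e : Word M} (h : IsPlusWord z e)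
    (hz : z.Pairwise fun x y => Γ.Adj x.1 y.1) {g k : GraphProduct Γ M}
    (heq : g * cls Γ z = k * cls Γ z) : g * cls Γ e = k * cls Γ e := by
  induction h generalizing g k with
  | nil => exact heq
  | @cons x f z e h1 h2 ih =>
    obtain ⟨hx, hz⟩ := List.pairwise_cons.1 hz
    have hc : Commute (cls Γ [x]) (cls Γ e) := commute_cls (IsPlusWord.adj h2 hx)
    have hc' : Commute (cls Γ [f]) (cls Γ e) := commute_cls (h1.fst_eq ▸ IsPlusWord.adj h2 hx)
    rw [cls_cons, ← mul_assoc, ← mul_assoc] at heq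
    have := ih hz heq
    rw [mul_assoc, mul_assoc, hc.eq, ← mul_assoc, ← mul_assoc] at this
    rw [cls_cons, hc'.eq, ← mul_assoc, ← mul_assoc]
    exact h1.mul_right_eq this

/-- A left Foata normal form whose first block has no left invertible letter is `R*`-related to
the idempotent of its first block. -/
lemma IsLeftFoata.rStar {vs : List (Word M)} (hf : IsLeftFoata Γ vs)
    (hinv : ∀ x ∈ firstBlock vs, ¬ LeftInvertible x) {e : Word M}
    (he : IsPlusWord (firstBlock vs) e) : RStar (cls Γ vs.flatten) (cls Γ e) := by
  cases vs with
  | nil =>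
    have : e = [] := List.forall₂_nil_left_iff.1 he
    subst this
    exact fun _ _ => Iff.rfl
  | cons z ws =>
    have hz := hf.pairwise_adj
    change IsPlusWord z e at he
    change ∀ x ∈ z, ¬ LeftInvertible x at hinv
    rw [List.flatten_cons, cls_append]
    intro g k
    constructor
    · intro heq
      -- A trivial last factor would make `fin x.1 g` a left inverse of `x`.
      have hne : ∀ g : GraphProduct Γ M, ∀ x ∈ z, fin x.1 (g * cls Γ z) ≠ 1 := fun g x hx h =>
        hinv x hx ⟨fin x.1 g, by rwa [fin_mul_clique hz hx] at h⟩
      rw [← mul_assoc, ← mul_assoc] at heq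
      exact he.mul_right_eq hz (hf.eq_of_mul_tail_eq (hne g) (hne k) heq)
    · intro heq
      rw [← he.mul_eq hz, mul_assoc, ← mul_assoc, heq, mul_assoc]

/-- Every decomposition of a word, together with a left inverse of its left invertible part, yields
an idempotent `R*`-related to the class of the word. -/
lemma IsDecomposition.rStar {u a : Word M} {vs : List (Word M)} {e a' : Word M}
    (h : IsDecomposition Γ u a vs) (he : IsPlusWord (firstBlock vs) e)
    (ha : cls Γ a' * cls Γ a = 1) :
    IsIdempotentElem (cls Γ a * cls Γ e * cls Γ a') ∧
      RStar (cls Γ u) (cls Γ a * cls Γ e * cls Γ a') := by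
  have hidem : IsIdempotentElem (cls Γ e) := by
    cases vs with
    | nil => exact he.isIdempotentElem (Γ := Γ) .nil
    | cons z ws => exact he.isIdempotentElem h.leftFoata.pairwise_adj
  have hr := h.leftFoata.rStar h.not_leftInvertible he
  refine ⟨?_, fun x y => ?_⟩
  · calc cls Γ a * cls Γ e * cls Γ a' * (cls Γ a * cls Γ e * cls Γ a')
        = cls Γ a * cls Γ e * (cls Γ a' * cls Γ a) * cls Γ e * cls Γ a' := by
          simp only [mul_assoc]
      _ = cls Γ a * cls Γ e * cls Γ a' := by
          rw [ha, mul_one, mul_assoc (cls Γ a), hidem.eq]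
  · rw [h.cls_eq, ← mul_assoc, ← mul_assoc, hr]
    constructor
    · intro heq
      rw [← mul_assoc, ← mul_assoc, ← mul_assoc, ← mul_assoc, heq]
    · intro heq
      -- Multiplying by `cls Γ a` on the right undoes `cls Γ a'`.
      have := congrArg (· * cls Γ a) heq
      simpa only [mul_assoc, ha, mul_one] using this

/-! ### Existence of decompositions. -/

/-- Every word can be shuffled into a product of left invertible letters followed by blocks in
left Foata form without left invertible letters in the first block. -/
lemma exists_shuffleEquiv (Γ : SimpleGraph V) (w : Word M) : ∃ (a : Word M) (vs : List (Word M)),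
    ShuffleEquiv Γ w (a ++ vs.flatten) ∧ (∀ x ∈ a, LeftInvertible x) ∧
    (∀ v ∈ vs, Γ.IsClique (support v)) ∧ IsFoataChain Γ vs ∧
    ∀ x ∈ firstBlock vs, ¬ LeftInvertible x := by
  induction w using List.reverseRecOn with
  | nil => exact ⟨[], [], ShuffleEquiv.refl _, by simp, by simp, List.isChain_nil,
      by simp [firstBlock]⟩
  | append_singleton w x ih =>
    obtain ⟨a, vs, h1, h2, h3, h4, h5⟩ := ih
    have h1' := h1.append (ShuffleEquiv.refl [x])
    rw [List.append_assoc] at h1'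
    -- A left invertible letter joins `a` when it commutes past all blocks. Any other letter is
    -- inserted: if it reaches the first block it is not left invertible, and if it is obstructed
    -- the first block does not change.
    by_cases hx : (∀ y ∈ vs.flatten, Γ.Adj x.1 y.1) ∧ LeftInvertible x
    · refine ⟨a ++ [x], vs, ?_, ?_, h3, h4, h5⟩
      · rw [List.append_assoc]
        exact h1'.trans ((ShuffleEquiv.refl a).append (ShuffleEquiv.singleton_append hx.1).symm)
      · intro y hy
        rcases List.mem_append.1 hy with hy | hy
        · exact h2 y hy
        · rw [List.mem_singleton.1 hy]
          exact hx.2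
    · refine ⟨a, insertLetter Γ x vs,
        h1'.trans ((ShuffleEquiv.refl a).append (shuffleEquiv_insertLetter x vs)), h2,
        isClique_insertLetter x h3, h4.insertLetter x, ?_⟩
      by_cases hadj : ∀ y ∈ vs.flatten, Γ.Adj x.1 y.1
      · intro y hy
        rcases firstBlock_insertLetter_subset x vs y hy with hy | rfl
        · exact h5 y hy
        · exact fun hinv => hx ⟨hadj, hinv⟩
      · rwa [firstBlock_insertLetter hadj]

lemma exists_isPlusWord (hM : ∀ α, IsLeftAbundant (M α)) (z : Word M) :
    ∃ e, IsPlusWord z e := by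
  induction z with
  | nil => exact ⟨[], .nil⟩
  | cons x z ih =>
    obtain ⟨e, he⟩ := ih
    obtain ⟨f, hf, hr⟩ := hM x.1 x.2
    exact ⟨⟨x.1, f⟩ :: e, .cons ⟨x.1, x.2, f, rfl, rfl, hf, fun a b => (hr a b).symm⟩ he⟩

variable (Γ) in
lemma exists_left_inverse {a : Word M} (h : ∀ x ∈ a, LeftInvertible x) :
    ∃ a' : Word M, cls Γ a' * cls Γ a = 1 := by
  induction a with
  | nil => exact ⟨[], by simp⟩
  | cons x a ih =>
    obtain ⟨a', ha⟩ := ih fun y hy => h y (by simp [hy])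
    obtain ⟨y, hy⟩ := h x (by simp)
    refine ⟨a' ++ [⟨x.1, y⟩], ?_⟩
    have : cls Γ [(⟨x.1, y⟩ : Letter M)] * cls Γ [x] = 1 := by
      rw [← cls_singleton_one Γ x.1, ← hy, ← cls_singleton_mul]
    rw [cls_append, cls_cons _ x, mul_assoc, ← mul_assoc _ (cls Γ [x]), this, one_mul, ha]

lemma exists_isDecomposition (hM : ∀ α, IsLeftAbundant (M α)) (u : Word M) :
    ∃ (a : Word M) (vs : List (Word M)) (v₁p a' : Word M),
      IsDecomposition Γ u a vs ∧ IsReducedWord Γ (a ++ vs.flatten) ∧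
      IsPlusWord (firstBlock vs) v₁p ∧ cls Γ a' * cls Γ a = 1 := by
  obtain ⟨w, hw, hcls⟩ := exists_isReducedWord (cls Γ u)
  obtain ⟨a, vs, h1, h2, h3, h4, h5⟩ := exists_shuffleEquiv Γ w
  obtain ⟨e, he⟩ := exists_isPlusWord hM (firstBlock vs)
  obtain ⟨a', ha⟩ := exists_left_inverse Γ h2
  have hred : IsReducedWord Γ (a ++ vs.flatten) := by
    rw [isReducedWord_iff_reduced_mk] at hw ⊢
    -- Reducedness depends only on the trace, so it survives the shuffle from `w`.
    rwa [← Trace.mk_eq_mk.2 h1]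
  exact ⟨a, vs, e, a', ⟨by rw [← hcls, h1.cls_eq, cls_append], h2,
    ⟨hred.of_append_right, h3, h4⟩, h5⟩, hred, he, ha⟩

end Foata

end GraphProd

theorem theorem5p19 {V : Type*} (Γ : SimpleGraph V) (M : V → Type*) [∀ α, Monoid (M α)]
    (hM : ∀ α, IsLeftAbundant (M α)) :
    IsLeftAbundant (GraphProduct Γ M) ∧
    (∀ u : Word M, ∃ (a : Word M) (vs : List (Word M)) (v₁p a' : Word M),
      IsDecomposition Γ u a vs ∧ IsReducedWord Γ (a ++ vs.flatten) ∧
      IsPlusWord (firstBlock vs) v₁p ∧ cls Γ a' * cls Γ a = 1) ∧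
    (∀ (u a : Word M) (vs : List (Word M)) (v₁p a' : Word M),
      IsDecomposition Γ u a vs → IsPlusWord (firstBlock vs) v₁p → cls Γ a' * cls Γ a = 1 →
      IsIdempotentElem (cls Γ a * cls Γ v₁p * cls Γ a') ∧
      RStar (cls Γ u) (cls Γ a * cls Γ v₁p * cls Γ a')) := by
  refine ⟨fun g => ?_, exists_isDecomposition hM, fun u a vs v₁p a' h he ha => h.rStar he ha⟩
  obtain ⟨u, rfl⟩ := cls_surjective Γ g
  obtain ⟨a, vs, e, a', h, -, he, ha⟩ := exists_isDecomposition (Γ := Γ) hM u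
  exact ⟨_, h.rStar he ha⟩
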